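/- **Setting.** Let $d,N,T,K$ be natural numbers with $K\le N$ and let $\delta\in(0,1)$; write $[n]=\{1,\dots,n\}$. Each product $i\in[N]$ has a known feature vector $x_i\in\mathbb{R}^d$ with $\|x_i\|_2\le 1$. There is an unknown $\theta^*\in\mathbb{R}^d$ with $\|\theta^*\|_2\le 1$ such that $\mu(i):=x_i^\top\theta^*\in[0,1]$ for all $i\in[N]$. The outcomes $r_{t,i}\in\{0,1\}$ ($t\in[T]$, $i\in[N]$) are random variables that are independent across products and across periods, with $\mathbb{E}[r_{t,i}]=\mu(i)$. Let $S^*\in\arg\max_{S\subset[N],\,|S|=K}\sum_{i\in S}\mu(i)$ be an optimal product set. **Algorithm ConsUCB with parameter $\alpha$.** Set $A_0=I_{d\times d}$, $b_0=0$. For $t=1,\dots,T$: put $\theta_t=A_{t-1}^{-1}b_{t-1}$, $A_{t,0}=A_{t-1}$. For $k=1,\dots,K$ select $$i_{t,k}\in\arg\max_{i\in[N]\setminus\{i_{t,1},\dots,i_{t,k-1}\}}p_{t,k}(i),\qquad p_{t,k}(i)=x_i^\top\theta_t-\alpha\sqrt{x_i^\top A_{t-1}^{-1}x_i}+2\alpha\sqrt{x_i^\top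 A_{t,k-1}^{-1}x_i},$$ and put $A_{t,k}=A_{t,k-1}+x_{i_{t,k}}x_{i_{t,k}}^\top$. Offer $S_t=\{i_{t,1},\dots,i_{t,K}\}$, observe $r_{t,i}$ for $i\in S_t$, and put $A_t=A_{t-1}+\sum_{i\in S_t}x_ix_i^\top$, $b_t=b_{t-1}+\sum_{i\in S_t}r_{t,i}x_i$. Ties are broken by any rule that does not anticipate: the choices in period $t$ may depend only on outcomes of the periods $1,\dots,t-1$ and on a random seed independent of all the outcomes. Put $\theta_{T+1}=A_T^{-1}b_T$ and $A_{T+1,0}=A_T$, and define $$\Delta_{t,k}(i)=\sqrt{x_i^\top A_{t,k}^{-1}x_i},\qquad \mathrm{LCB}_t(i)=x_i^\top\theta_t-\alpha\Delta_{t,0}(i).$$ **Proposition.** If ConsUCB is run with $\alpha=\sqrt{d\,\ln\!\left(\frac{1+N+TN}{\delta}\right)}+1$, then with probability at least $1-\delta$ the following hold for all $t\in[T]$ and $k\in[K]$ simultaneously: 1. if $i_{t,k}\notin S^*$, then for all $i^*\in S^*\setminus S_t$, $$\mu(i^*)-\mu(i_{t,k})\le \mathrm{LCB}_{t+1}(i^*)-\mathrm{LCB}_t(i^*)+2\alpha\Delta_{t,k-1}(i_{t,k});$$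 2. if $i_{t,k}\in S^*$, then $$0\le \mathrm{LCB}_{t+1}(i_{t,k})-\mathrm{LCB}_t(i_{t,k})+2\alpha\Delta_{t,k-1}(i_{t,k}).$$ -/

import Mathlib

open MeasureTheory ProbabilityTheory
open scoped Matrix

noncomputable section

namespace ConsUCB

/-! Vectors of `ℝ^d` are functions `Fin d → ℝ`, products are elements of `Fin N`.
Periods `t = 1, …, T` and selection steps `k = 1, …, K` are numbered from one.
`sel t k` is the product selected in step `k` of period `t`, and `y t j` is the outcome of
product `j` in period `t`, of which only the values with `j ∈ S_t` are ever used. -/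

variable {d N : ℕ}

/-- The mean `μ(j) = x_jᵀ θ` of the outcome of product `j`. -/
def mean (x : Fin N → Fin d → ℝ) (θ : Fin d → ℝ) (j : Fin N) : ℝ := x j ⬝ᵥ θ

/-- `S` is an optimal product set: `K` products whose total mean is the largest possible. -/
def IsOptimalSet (K : ℕ) (x : Fin N → Fin d → ℝ) (θ : Fin d → ℝ) (S : Finset (Fin N)) : Prop :=
  S.card = K ∧
    ∀ S' : Finset (Fin N), S'.card = K → ∑ j ∈ S', mean x θ j ≤ ∑ j ∈ S, mean x θ j

/-- The products selected in the first `k` steps of period `t`. -/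
def selected (sel : ℕ → ℕ → Fin N) (t k : ℕ) : Finset (Fin N) := (Finset.Icc 1 k).image (sel t)

/-- `A_t`, with `A_0 = I` and `A_t = A_{t-1} + ∑_{j ∈ S_t} x_j x_jᵀ`,
where `S_t = selected sel t K`. -/
def A (K : ℕ) (x : Fin N → Fin d → ℝ) (sel : ℕ → ℕ → Fin N) : ℕ → Matrix (Fin d) (Fin d) ℝ
  | 0 => 1
  | t + 1 => A K x sel t + ∑ j ∈ selected sel (t + 1) K, Matrix.vecMulVec (x j) (x j)

/-- `b_t`, with `b_0 = 0` and `b_t = b_{t-1} + ∑_{j ∈ S_t} y_{t,j} x_j`. -/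
def b (K : ℕ) (x : Fin N → Fin d → ℝ) (sel : ℕ → ℕ → Fin N) (y : ℕ → Fin N → ℝ) :
    ℕ → Fin d → ℝ
  | 0 => 0
  | t + 1 => b K x sel y t + ∑ j ∈ selected sel (t + 1) K, y (t + 1) j • x j

/-- The estimate `θ_t = A_{t-1}⁻¹ b_{t-1}`, for `t ≥ 1`. -/
def thetaHat (K : ℕ) (x : Fin N → Fin d → ℝ) (sel : ℕ → ℕ → Fin N) (y : ℕ → Fin N → ℝ)
    (t : ℕ) : Fin d → ℝ :=
  (A K x sel (t - 1))⁻¹ *ᵥ b K x sel y (t - 1)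

/-- `A_{t,k}` for `t ≥ 1`, with `A_{t,0} = A_{t-1}` and `A_{t,k} = A_{t,k-1} + x_j x_jᵀ` for the
product `j` selected in step `k` of period `t`. -/
def Astep (K : ℕ) (x : Fin N → Fin d → ℝ) (sel : ℕ → ℕ → Fin N) (t : ℕ) :
    ℕ → Matrix (Fin d) (Fin d) ℝ
  | 0 => A K x sel (t - 1)
  | k + 1 => Astep K x sel t k + Matrix.vecMulVec (x (sel t (k + 1))) (x (sel t (k + 1)))

/-- `Δ_{t,k}(j) = √(x_jᵀ A_{t,k}⁻¹ x_j)`. -/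
def Delta (K : ℕ) (x : Fin N → Fin d → ℝ) (sel : ℕ → ℕ → Fin N) (t k : ℕ) (j : Fin N) : ℝ :=
  √(x j ⬝ᵥ ((Astep K x sel t k)⁻¹ *ᵥ x j))

/-- The lower confidence bound `LCB_t(j) = x_jᵀ θ_t - α Δ_{t,0}(j)`. -/
def LCB (K : ℕ) (α : ℝ) (x : Fin N → Fin d → ℝ) (sel : ℕ → ℕ → Fin N) (y : ℕ → Fin N → ℝ)
    (t : ℕ) (j : Fin N) : ℝ :=
  x j ⬝ᵥ thetaHat K x sel y t - α * Delta K x sel t 0 j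

/-- The score `p_{t,k}(j)`, for `t, k ≥ 1`. -/
def score (K : ℕ) (α : ℝ) (x : Fin N → Fin d → ℝ) (sel : ℕ → ℕ → Fin N) (y : ℕ → Fin N → ℝ)
    (t k : ℕ) (j : Fin N) : ℝ :=
  x j ⬝ᵥ thetaHat K x sel y t
    - α * √(x j ⬝ᵥ ((A K x sel (t - 1))⁻¹ *ᵥ x j))
    + 2 * α * √(x j ⬝ᵥ ((Astep K x sel t (k - 1))⁻¹ *ᵥ x j))

/-- The selections `sel` are those of a run of ConsUCB with parameter `α` over `T` periods on the
outcomes `y`: in each step of each period the selected product has the largest score among the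
products that are not selected yet in this period. Ties may be broken in any way. -/
def IsRun (T K : ℕ) (α : ℝ) (x : Fin N → Fin d → ℝ) (sel : ℕ → ℕ → Fin N)
    (y : ℕ → Fin N → ℝ) : Prop :=
  ∀ t ∈ Set.Icc 1 T, ∀ k ∈ Set.Icc 1 K,
    sel t k ∉ selected sel t (k - 1) ∧
    ∀ j, j ∉ selected sel t (k - 1) → score K α x sel y t k j ≤ score K α x sel y t k (sel t k)

/-- The information available before the outcomes of period `t`: an additional random seed `V`
(for breaking ties) and the outcomes of the periods `1, …, t - 1`. -/
abbrev history {Ω 𝓥 : Type*} [MeasurableSpace 𝓥] (V : Ω → 𝓥) (r : ℕ → Fin N → Ω → ℝ) (t : ℕ) :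
    MeasurableSpace Ω :=
  MeasurableSpace.comap V inferInstance ⊔
    ⨆ s ∈ Set.Ico 1 t, ⨆ j : Fin N, MeasurableSpace.comap (r s j) inferInstance

/-- The outcome model over `T` periods: binary outcomes `r t j`, independent across products and
periods, with `𝔼[r t j] = x_jᵀ θ`. -/
structure IsOutcomeModel {Ω : Type*} [MeasurableSpace Ω] (P : Measure Ω) (T : ℕ)
    (x : Fin N → Fin d → ℝ) (θ : Fin d → ℝ) (r : ℕ → Fin N → Ω → ℝ) : Prop where
  measurable : ∀ t ∈ Set.Icc 1 T, ∀ j, Measurable (r t j)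
  binary : ∀ t ∈ Set.Icc 1 T, ∀ j ω, r t j ω = 0 ∨ r t j ω = 1
  indep : iIndepFun (fun (p : Set.Icc 1 T × Fin N) => r p.1 p.2) P
  expectation : ∀ t ∈ Set.Icc 1 T, ∀ j, ∫ ω, r t j ω ∂P = mean x θ j

end ConsUCB

end

/-! Two parts meet here: a deterministic comparison and a self-normalised confidence bound.
Comparison (`mean_le_of_forall_abs_le`): the score is `LCB_t + 2αΔ_{t,k-1}`. If every mean lies
within `αΔ_{t,0}` of its estimate for each `t ≤ T + 1`, then `LCB_t` bounds it below, and `LCB_{t+1}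
+ 2αΔ_{t,k-1}` bounds it above because the matrices only grow. Maximality of the selected score
links the two bounds. Confidence: with `s_t` the accumulated noise, `exp (s_tᵀ A_t⁻¹ s_t) / det A_t`
is a supermartingale. A rank-one update multiplies the determinant by `1 + v`, where `v = xᵀ A⁻¹ x`;
by Hoeffding's lemma this pays for the expected growth of the exponential
(`lintegral_expRatio_add_le`). Ville's inequality keeps the process below `1/δ` at all times with
probability at least `1 - δ`. There, `det A_t ≤ (1 + tN)^d` gives `√(s_tᵀ A_t⁻¹ s_t) ≤ α - 1`; the
remaining `1` absorbs the bias of the regulariser `A_0 = I`. -/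

namespace ConsUCB

/-! ### Rank-one updates of positive definite matrices -/

section LinearAlgebra

variable {n : Type*} [Fintype n]

lemma posDef_add_vecMulVec {A : Matrix n n ℝ} (hA : A.PosDef) (x : n → ℝ) :
    (A + Matrix.vecMulVec x x).PosDef := by
  refine hA.add_posSemidef ?_
  simpa using Matrix.posSemidef_vecMulVec_self_star x

lemma posDef_add_sum_vecMulVec {ι : Type*} {A : Matrix n n ℝ} (hA : A.PosDef) (x : ι → n → ℝ)
    (S : Finset ι) : (A + ∑ j ∈ S, Matrix.vecMulVec (x j) (x j)).PosDef := by
  refine hA.add_posSemidef (Matrix.posSemidef_sum _ fun j _ => ?_)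
  simpa using Matrix.posSemidef_vecMulVec_self_star (x j)

lemma sq_dotProduct_le {x v : n → ℝ} (hx : ‖WithLp.toLp 2 x‖ ≤ 1) : (x ⬝ᵥ v) ^ 2 ≤ v ⬝ᵥ v := by
  have h1 : x ⬝ᵥ x ≤ 1 := by
    have := pow_le_one₀ (norm_nonneg _) hx (n := 2)
    rw [EuclideanSpace.norm_sq_eq] at this
    simpa [dotProduct, sq] using this
  have h2 : (x ⬝ᵥ v) ^ 2 ≤ (x ⬝ᵥ x) * (v ⬝ᵥ v) := by
    simpa [dotProduct, sq] using Finset.sum_mul_sq_le_sq_mul_sq Finset.univ x v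
  have h3 : 0 ≤ v ⬝ᵥ v := by
    exact Finset.sum_nonneg fun i _ => mul_self_nonneg (v i)
  nlinarith

variable [DecidableEq n]

lemma isUnit_det_of_posDef {A : Matrix n n ℝ} (hA : A.PosDef) : IsUnit A.det :=
  (Matrix.isUnit_iff_isUnit_det A).1 hA.isUnit

lemma dotProduct_inv_mulVec_comm {A : Matrix n n ℝ} (hA : A.PosDef) (x y : n → ℝ) :
    x ⬝ᵥ (A⁻¹ *ᵥ y) = y ⬝ᵥ (A⁻¹ *ᵥ x) := by
  have h : (A⁻¹)ᵀ = A⁻¹ := by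
    have := hA.inv.isHermitian.eq
    rwa [Matrix.conjTranspose_eq_transpose_of_trivial] at this
  rw [Matrix.dotProduct_mulVec, ← Matrix.mulVec_transpose, h, dotProduct_comm]

/-- The squared norm `sᵀ A⁻¹ s`. -/
noncomputable def invNormSq (A : Matrix n n ℝ) (s : n → ℝ) : ℝ := s ⬝ᵥ (A⁻¹ *ᵥ s)

lemma invNormSq_nonneg {A : Matrix n n ℝ} (hA : A.PosDef) (s : n → ℝ) : 0 ≤ invNormSq A s := by
  simpa [invNormSq] using hA.inv.posSemidef.dotProduct_mulVec_nonneg s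

/-- The Sherman–Morrison formula for a symmetric rank-one update. -/
lemma inv_add_vecMulVec {A : Matrix n n ℝ} (hA : A.PosDef) (x : n → ℝ) :
    (A + Matrix.vecMulVec x x)⁻¹ =
      A⁻¹ - (1 + invNormSq A x)⁻¹ • Matrix.vecMulVec (A⁻¹ *ᵥ x) (A⁻¹ *ᵥ x) := by
  have hv : 1 + invNormSq A x ≠ 0 := by linarith [invNormSq_nonneg hA x]
  have hsymm : x ᵥ* A⁻¹ = A⁻¹ *ᵥ x := by
    have := hA.inv.isHermitian.eq
    rw [Matrix.conjTranspose_eq_transpose_of_trivial] at this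
    rw [← Matrix.mulVec_transpose, this]
  have hdet := isUnit_det_of_posDef hA
  refine Matrix.inv_eq_right_inv ?_
  rw [add_mul, mul_sub, mul_sub, Matrix.mul_nonsing_inv _ hdet, Matrix.mul_smul, Matrix.mul_smul,
    Matrix.mul_vecMulVec, Matrix.vecMulVec_mul, Matrix.vecMulVec_mul_vecMulVec, hsymm,
    Matrix.mulVec_mulVec, Matrix.mul_nonsing_inv _ hdet, Matrix.one_mulVec]
  change _ - _ + (_ - _ • Matrix.vecMulVec x (invNormSq A x • (A⁻¹ *ᵥ x))) = _
  rw [Matrix.vecMulVec_smul, smul_smul]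
  have : (1 + invNormSq A x)⁻¹ * invNormSq A x = 1 - (1 + invNormSq A x)⁻¹ := by field_simp; ring
  rw [this, sub_smul, one_smul]
  abel

lemma det_add_vecMulVec {A : Matrix n n ℝ} (hA : A.PosDef) (x : n → ℝ) :
    (A + Matrix.vecMulVec x x).det = A.det * (1 + invNormSq A x) := by
  rw [Matrix.vecMulVec_eq Unit, Matrix.det_add_replicateCol_mul_replicateRow
    (isUnit_det_of_posDef hA)]
  congr 1
  simp [Matrix.det_unique, Matrix.mul_apply, invNormSq, dotProduct, Matrix.mulVec, Finset.mul_sum,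
    Finset.sum_mul]
  rw [Finset.sum_comm]
  refine Finset.sum_congr rfl fun i _ => Finset.sum_congr rfl fun j _ => by ring

/-- Expanding Sherman–Morrison isolates the term linear in the noise `ε`, to which Hoeffding's lemma
applies, from the term in `ε ^ 2` and the negative square that compensates for the Hoeffding bound.
-/
lemma invNormSq_add_vecMulVec {A : Matrix n n ℝ} (hA : A.PosDef) (x s : n → ℝ) (ε : ℝ) :
    invNormSq (A + Matrix.vecMulVec x x) (s + ε • x) = invNormSq A s +
      (2 * ε * (x ⬝ᵥ (A⁻¹ *ᵥ s)) + ε ^ 2 * invNormSq A x - (x ⬝ᵥ (A⁻¹ *ᵥ s)) ^ 2) /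
        (1 + invNormSq A x) := by
  have hv : 1 + invNormSq A x ≠ 0 := by linarith [invNormSq_nonneg hA x]
  have hs : s ⬝ᵥ (A⁻¹ *ᵥ x) = x ⬝ᵥ (A⁻¹ *ᵥ s) := dotProduct_inv_mulVec_comm hA s x
  rw [invNormSq, inv_add_vecMulVec hA]
  simp only [Matrix.sub_mulVec, Matrix.smul_mulVec, Matrix.vecMulVec_mulVec, Matrix.mulVec_add,
    Matrix.mulVec_smul, dotProduct_add, add_dotProduct, dotProduct_sub, dotProduct_smul,
    smul_dotProduct, smul_eq_mul, op_smul_eq_smul, hs]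
  simp only [dotProduct_comm (A⁻¹ *ᵥ x), hs]
  simp only [invNormSq] at hv ⊢
  field_simp
  ring

lemma invNormSq_add_vecMulVec_le {A : Matrix n n ℝ} (hA : A.PosDef) (x s : n → ℝ) :
    invNormSq (A + Matrix.vecMulVec x x) s ≤ invNormSq A s := by
  have h := invNormSq_add_vecMulVec hA x s 0
  have h2 : 0 ≤ (x ⬝ᵥ (A⁻¹ *ᵥ s)) ^ 2 / (1 + invNormSq A x) :=
    div_nonneg (sq_nonneg _) (by linarith [invNormSq_nonneg hA x])
  simp only [zero_smul, add_zero, mul_zero, zero_mul, ne_eq, OfNat.ofNat_ne_zero,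
    not_false_eq_true, zero_pow, zero_sub, neg_div] at h
  linarith

lemma invNormSq_add_sum_vecMulVec_le {ι : Type*} {A : Matrix n n ℝ} (hA : A.PosDef)
    (x : ι → n → ℝ) (S : Finset ι) (s : n → ℝ) :
    invNormSq (A + ∑ j ∈ S, Matrix.vecMulVec (x j) (x j)) s ≤ invNormSq A s := by
  classical
  induction S using Finset.induction_on with
  | empty => simp
  | insert j S hj ih =>
    rw [Finset.sum_insert hj, add_comm (Matrix.vecMulVec _ _), ← add_assoc]
    exact (invNormSq_add_vecMulVec_le (posDef_add_sum_vecMulVec hA x S) _ _).trans ih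

/-- Cauchy–Schwarz for the inner product of `A⁻¹`, from the discriminant of the nonnegative
quadratic `c ↦ invNormSq A (y + c • x)`. -/
lemma abs_dotProduct_inv_mulVec_le {A : Matrix n n ℝ} (hA : A.PosDef) (x y : n → ℝ) :
    |x ⬝ᵥ (A⁻¹ *ᵥ y)| ≤ √(invNormSq A x) * √(invNormSq A y) := by
  have h : ∀ c : ℝ, 0 ≤ invNormSq A x * (c * c) + (2 * (x ⬝ᵥ (A⁻¹ *ᵥ y))) * c + invNormSq A y := by
    intro c
    have h := invNormSq_nonneg hA (y + c • x)
    have e : invNormSq A (y + c • x) =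
        invNormSq A x * (c * c) + (2 * (x ⬝ᵥ (A⁻¹ *ᵥ y))) * c + invNormSq A y := by
      simp only [invNormSq, Matrix.mulVec_add, Matrix.mulVec_smul, dotProduct_add, add_dotProduct,
        dotProduct_smul, smul_dotProduct, smul_eq_mul, dotProduct_inv_mulVec_comm hA y x]
      ring
    rwa [e] at h
  have hd := discrim_le_zero h
  rw [discrim] at hd
  rw [← Real.sqrt_mul (invNormSq_nonneg hA x), ← Real.sqrt_sq_eq_abs]
  exact Real.sqrt_le_sqrt (by linarith)

/-- The determinant is the product of the eigenvalues, each of which is the value of the form at a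
unit eigenvector. -/
lemma det_le_pow_of_forall_dotProduct_mulVec_le {A : Matrix n n ℝ} (hA : A.PosDef) {c : ℝ}
    (h : ∀ v : n → ℝ, v ⬝ᵥ (A *ᵥ v) ≤ c * (v ⬝ᵥ v)) : A.det ≤ c ^ Fintype.card n := by
  rw [hA.isHermitian.det_eq_prod_eigenvalues, ← Finset.card_univ, ← Finset.prod_const]
  refine Finset.prod_le_prod (fun i _ => by simpa using (hA.eigenvalues_pos i).le) fun i _ => ?_
  have h1 := h (hA.isHermitian.eigenvectorBasis i)
  have h2 : (hA.isHermitian.eigenvectorBasis i : n → ℝ) ⬝ᵥ hA.isHermitian.eigenvectorBasis i = 1 := by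
    have := hA.isHermitian.eigenvectorBasis.orthonormal.1 i
    rw [EuclideanSpace.norm_eq, Real.sqrt_eq_one] at this
    rw [← this]
    simp [dotProduct, sq]
  rw [hA.isHermitian.mulVec_eigenvectorBasis, dotProduct_smul, h2] at h1
  simpa using h1

end LinearAlgebra

/-! ### Independence, freezing and Ville's inequality -/

section Independence

variable {Ω : Type*} {m₀ m₁ m₂ mΩ : MeasurableSpace Ω} {P : Measure Ω}

/-- On the π-system of intersections `a ∩ b` generating `m₀ ⊔ m₁`, the two hypotheses factor `P (a ∩
b ∩ c)` in turn. In the application these are seed, past and present. -/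
lemma indep_sup_of_indep_sup [IsProbabilityMeasure P]
    (h₀ : m₀ ≤ mΩ) (h₁ : m₁ ≤ mΩ) (h₂ : m₂ ≤ mΩ) (h : Indep m₀ (m₁ ⊔ m₂) P)
    (h' : Indep m₁ m₂ P) : Indep (m₀ ⊔ m₁) m₂ P := by
  let π : Set (Set Ω) := {s | ∃ a b, MeasurableSet[m₀] a ∧ MeasurableSet[m₁] b ∧ s = a ∩ b}
  have hπ : m₀ ⊔ m₁ = MeasurableSpace.generateFrom π := by
    refine le_antisymm (sup_le ?_ ?_) (MeasurableSpace.generateFrom_le ?_)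
    · intro s hs
      exact MeasurableSpace.measurableSet_generateFrom
        ⟨s, Set.univ, hs, MeasurableSet.univ, (Set.inter_univ s).symm⟩
    · intro s hs
      exact MeasurableSpace.measurableSet_generateFrom
        ⟨Set.univ, s, MeasurableSet.univ, hs, (Set.univ_inter s).symm⟩
    · rintro _ ⟨a, b, ha, hb, rfl⟩
      have hle₀ : m₀ ≤ m₀ ⊔ m₁ := le_sup_left
      have hle₁ : m₁ ≤ m₀ ⊔ m₁ := le_sup_right
      exact MeasurableSet.inter (hle₀ _ ha) (hle₁ _ hb)
  have hpi : IsPiSystem π := by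
    rintro _ ⟨a, b, ha, hb, rfl⟩ _ ⟨a', b', ha', hb', rfl⟩ _
    exact ⟨a ∩ a', b ∩ b', ha.inter ha', hb.inter hb', Set.inter_inter_inter_comm _ _ _ _⟩
  refine IndepSets.indep (sup_le h₀ h₁) h₂ hpi
    (@MeasurableSpace.isPiSystem_measurableSet Ω m₂) hπ
    (@MeasurableSpace.generateFrom_measurableSet Ω m₂).symm ?_
  rw [IndepSets_iff]
  rintro _ c ⟨a, b, ha, hb, rfl⟩ hc
  have hle₁ : m₁ ≤ m₁ ⊔ m₂ := le_sup_left
  have hle₂ : m₂ ≤ m₁ ⊔ m₂ := le_sup_right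
  rw [Indep_iff] at h h'
  rw [Set.inter_assoc, h a (b ∩ c) ha (MeasurableSet.inter (hle₁ _ hb) (hle₂ _ hc)), h' b c hb hc,
    h a b ha (hle₁ _ hb), mul_assoc]

/-- Freezing: `R` is independent of `m₀`, so it may be integrated out first with `Z` held fixed.
Testing on all `B` in `m₀` replaces a conditional expectation. -/
lemma setLIntegral_comp_le_of_indep [IsProbabilityMeasure P] {𝓩 𝓡 : Type*} [MeasurableSpace 𝓩]
    [MeasurableSpace 𝓡] (hm : m₀ ≤ mΩ) {Z : Ω → 𝓩} {R : Ω → 𝓡}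
    (hZ : Measurable[m₀] Z) (hR : Measurable R)
    (hind : Indep m₀ (MeasurableSpace.comap R inferInstance) P)
    {f : 𝓩 × 𝓡 → ENNReal} (hf : Measurable f) {g : Ω → ENNReal}
    (hg : ∀ ω, ∫⁻ ω', f (Z ω, R ω') ∂P ≤ g ω) {B : Set Ω} (hB : MeasurableSet[m₀] B) :
    ∫⁻ ω in B, f (Z ω, R ω) ∂P ≤ ∫⁻ ω in B, g ω ∂P := by
  have hI : Measurable[m₀] (B.indicator (fun _ => (1 : ENNReal))) :=
    (measurable_indicator_const_iff (1 : ENNReal)).2 hB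
  -- The indicator of `B` joins the frozen variable, so that independence of one pair covers the
  -- restricted integral.
  let Z' : Ω → ENNReal × 𝓩 := fun ω => (B.indicator (fun _ => 1) ω, Z ω)
  have hZ' : Measurable[m₀] Z' := Measurable.prodMk hI hZ
  have hZ'm : Measurable Z' := hZ'.mono hm le_rfl
  have hindep : IndepFun Z' R P := by
    rw [IndepFun_iff_Indep]
    exact indep_of_indep_of_le_left hind hZ'.comap_le
  let F : (ENNReal × 𝓩) × 𝓡 → ENNReal := fun p => p.1.1 * f (p.1.2, p.2)
  have hF : Measurable F := by fun_prop
  have e1 : ∀ h : Ω → ENNReal,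
      ∫⁻ ω in B, h ω ∂P = ∫⁻ ω, B.indicator (fun _ => 1) ω * h ω ∂P := by
    intro h
    rw [← lintegral_indicator (hm B hB)]
    refine lintegral_congr fun ω => ?_
    by_cases hω : ω ∈ B <;> simp [hω]
  calc ∫⁻ ω in B, f (Z ω, R ω) ∂P = ∫⁻ ω, F (Z' ω, R ω) ∂P := e1 _
    _ = ∫⁻ p, F p ∂(P.map fun ω => (Z' ω, R ω)) := (lintegral_map hF (hZ'm.prodMk hR)).symm
    _ = ∫⁻ z, ∫⁻ ρ, F (z, ρ) ∂(P.map R) ∂(P.map Z') := by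
      rw [hindep.map_prod_eq_prod_map_map hZ'm.aemeasurable hR.aemeasurable,
        lintegral_prod _ hF.aemeasurable]
    _ = ∫⁻ ω, ∫⁻ ω', F (Z' ω, R ω') ∂P ∂P := by
      rw [lintegral_map hF.lintegral_prod_right' hZ'm]
      refine lintegral_congr fun ω => ?_
      exact lintegral_map (hF.comp measurable_prodMk_left) hR
    _ ≤ ∫⁻ ω, B.indicator (fun _ => 1) ω * g ω ∂P := by
      refine lintegral_mono fun ω => ?_
      change ∫⁻ ω', B.indicator (fun _ => 1) ω * f (Z ω, R ω') ∂P ≤ _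
      rw [lintegral_const_mul _ (by fun_prop)]
      gcongr
      exact hg ω
    _ = ∫⁻ ω in B, g ω ∂P := (e1 _).symm

/-- Ville's maximal inequality on a finite horizon. -/
lemma measure_exists_le_of_supermartingale {T : ℕ} (ℱ : ℕ → MeasurableSpace Ω)
    (hℱ : ∀ t ≤ T, ℱ t ≤ mΩ) (hmono : Monotone ℱ) (M : ℕ → Ω → ENNReal)
    (hM : ∀ t ≤ T, Measurable[ℱ t] (M t)) (h0 : ∫⁻ ω, M 0 ω ∂P ≤ 1)
    (hstep : ∀ t < T, ∀ B, MeasurableSet[ℱ t] B → ∫⁻ ω in B, M (t + 1) ω ∂P ≤ ∫⁻ ω in B, M t ω ∂P)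
    (c : ENNReal) :
    c * P {ω | ∃ t ≤ T, c ≤ M t ω} ≤ 1 := by
  let E : ℕ → Set Ω := fun n => {ω | ∃ t ≤ n, c ≤ M t ω}
  have hlevel : ∀ t ≤ T, MeasurableSet[ℱ t] {ω | c ≤ M t ω} := fun t ht =>
    (hM t ht) measurableSet_Ici
  have hE : ∀ n ≤ T, MeasurableSet[ℱ n] (E n) := by
    intro n hn
    have : E n = ⋃ t ∈ Set.Iic n, {ω | c ≤ M t ω} := by ext; simp [E]
    rw [this]
    exact @MeasurableSet.biUnion _ _ (ℱ n) _ _ (Set.to_countable _) fun t ht =>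
      hmono ht _ (hlevel t (le_trans ht hn))
  have hsplit : ∀ n ≤ T, ∀ B, MeasurableSet B →
      c * P (B ∩ {ω | c ≤ M n ω}) + ∫⁻ ω in B \ {ω | c ≤ M n ω}, M n ω ∂P ≤
        ∫⁻ ω in B, M n ω ∂P := by
    intro n hn B hB
    have hL := hℱ n hn _ (hlevel n hn)
    rw [← lintegral_inter_add_sdiff _ B hL]
    gcongr
    rw [← setLIntegral_const]
    exact setLIntegral_mono' (hB.inter hL) fun ω hω => hω.2
  -- The invariant of the stopped process: paths that have reached `c` are charged `c`, all others
  -- their current value.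
  have key : ∀ n ≤ T, c * P (E n) + ∫⁻ ω in (E n)ᶜ, M n ω ∂P ≤ 1 := by
    intro n
    induction n with
    | zero =>
      intro hn
      have := hsplit 0 hn Set.univ MeasurableSet.univ
      have hE0 : E 0 = {ω | c ≤ M 0 ω} := by ext; simp [E]
      rw [hE0]
      simpa [Set.compl_eq_univ_sdiff] using this.trans (by simpa using h0)
    | succ n ih =>
      intro hn
      have hn' : n ≤ T := by omega
      have hEn := hE n hn'
      have hEn' := hℱ n hn' _ hEn
      have e1 : E (n + 1) = E n ∪ ((E n)ᶜ ∩ {ω | c ≤ M (n + 1) ω}) := by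
        ext ω
        simp only [E, Set.mem_ofPred_eq, Set.mem_union, Set.mem_inter_iff, Set.mem_compl_iff]
        constructor
        · rintro ⟨t, ht, h⟩
          by_cases hc : ∃ t ≤ n, c ≤ M t ω
          · exact Or.inl hc
          · refine Or.inr ⟨hc, ?_⟩
            rcases Nat.lt_or_ge n t with h' | h'
            · rwa [show t = n + 1 by omega] at h
            · exact absurd ⟨t, h', h⟩ hc
        · rintro (⟨t, ht, h⟩ | ⟨_, h⟩)
          · exact ⟨t, by omega, h⟩
          · exact ⟨n + 1, le_rfl, h⟩
      have e2 : (E (n + 1))ᶜ = (E n)ᶜ \ {ω | c ≤ M (n + 1) ω} := by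
        rw [e1]; ext ω; simp only [Set.mem_compl_iff, Set.mem_union, Set.mem_inter_iff,
          Set.mem_sdiff]; tauto
      calc c * P (E (n + 1)) + ∫⁻ ω in (E (n + 1))ᶜ, M (n + 1) ω ∂P
          ≤ (c * P (E n) + c * P ((E n)ᶜ ∩ {ω | c ≤ M (n + 1) ω})) +
              ∫⁻ ω in (E n)ᶜ \ {ω | c ≤ M (n + 1) ω}, M (n + 1) ω ∂P := by
            rw [e2, ← mul_add]
            gcongr
            rw [e1]
            exact measure_union_le _ _
        _ ≤ c * P (E n) + ∫⁻ ω in (E n)ᶜ, M (n + 1) ω ∂P := by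
            rw [add_assoc]
            gcongr
            exact hsplit (n + 1) hn _ hEn'.compl
        _ ≤ c * P (E n) + ∫⁻ ω in (E n)ᶜ, M n ω ∂P := by
            exact add_le_add_right (hstep n hn _ hEn.compl) _
        _ ≤ 1 := ih hn'
  exact le_self_add.trans (key T le_rfl)

end Independence

/-! ### One-step bounds for the exponential ratio -/

section ExponentialProcess

instance {m n : Type*} : MeasurableSpace (Matrix m n ℝ) :=
  inferInstanceAs (MeasurableSpace (m → n → ℝ))

instance {m n : Type*} [Fintype m] [Fintype n] : SecondCountableTopology (Matrix m n ℝ) :=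
  inferInstanceAs (SecondCountableTopology (m → n → ℝ))

instance {m n : Type*} [Fintype m] [Fintype n] : BorelSpace (Matrix m n ℝ) :=
  inferInstanceAs (BorelSpace (m → n → ℝ))

variable {n : Type*} [Fintype n] [DecidableEq n]

/-- The ratio `exp (sᵀ A⁻¹ s) / det A`. -/
noncomputable def expRatio (A : Matrix n n ℝ) (s : n → ℝ) : ENNReal :=
  ENNReal.ofReal (Real.exp (invNormSq A s) / A.det)

lemma measurable_expRatio :
    Measurable fun p : Matrix n n ℝ × (n → ℝ) => expRatio p.1 p.2 := by
  have hdet : Measurable fun p : Matrix n n ℝ × (n → ℝ) => p.1.det :=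
    (continuous_fst.matrix_det).measurable
  have hadj : Measurable fun p : Matrix n n ℝ × (n → ℝ) => p.2 ⬝ᵥ (p.1.adjugate *ᵥ p.2) :=
    (continuous_snd.dotProduct (continuous_fst.matrix_adjugate.matrix_mulVec
      continuous_snd)).measurable
  -- Writing the inverse through the adjugate leaves polynomials and one scalar inverse, with no
  -- invertibility needed.
  have h : (fun p : Matrix n n ℝ × (n → ℝ) => invNormSq p.1 p.2) =
      fun p => p.1.det⁻¹ * (p.2 ⬝ᵥ (p.1.adjugate *ᵥ p.2)) := by
    funext p
    rw [invNormSq, Matrix.inv_def, Ring.inverse_eq_inv', Matrix.smul_mulVec, dotProduct_smul,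
      smul_eq_mul]
  have hq : Measurable fun p : Matrix n n ℝ × (n → ℝ) => invNormSq p.1 p.2 := by
    rw [h]; exact hdet.inv.mul hadj
  exact (hq.exp.div hdet).ennreal_ofReal

lemma _root_.Measurable.expRatio {α : Type*} [MeasurableSpace α] {f : α → Matrix n n ℝ}
    {g : α → n → ℝ} (hf : Measurable f) (hg : Measurable g) :
    Measurable fun a => expRatio (f a) (g a) := by
  have h := measurable_expRatio.comp (hf.prodMk hg)
  exact h

/-- Take reciprocals in `1 + z ≤ exp z` at `z = -(v / (1 + v))`. -/
lemma exp_div_one_add_le {v : ℝ} (hv : 0 ≤ v) : Real.exp (v / (1 + v)) ≤ 1 + v := by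
  have h1 : 0 < 1 + v := by linarith
  have h := Real.add_one_le_exp (-(v / (1 + v)))
  have h2 : -(v / (1 + v)) + 1 = (1 + v)⁻¹ := by field_simp; ring
  rw [h2, Real.exp_neg] at h
  exact (inv_le_inv₀ h1 (Real.exp_pos _)).1 h

variable {Ω : Type*} [MeasurableSpace Ω] {P : Measure Ω} [IsProbabilityMeasure P]

/-- Hoeffding's lemma: a variable in an interval of length one has variance proxy `1/4`. -/
lemma lintegral_exp_mul_sub_le {X : Ω → ℝ} (hX : Measurable X) (h01 : ∀ ω, X ω ∈ Set.Icc (0 : ℝ) 1)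
    (c : ℝ) :
    ∫⁻ ω, ENNReal.ofReal (Real.exp (c * (X ω - ∫ ω', X ω' ∂P))) ∂P ≤
      ENNReal.ofReal (Real.exp (c ^ 2 / 8)) := by
  have h := hasSubgaussianMGF_of_mem_Icc (μ := P) hX.aemeasurable (Filter.Eventually.of_forall h01)
  rw [← ofReal_integral_eq_lintegral_ofReal (h.integrable_exp_mul c)
    (Filter.Eventually.of_forall fun _ => (Real.exp_pos _).le)]
  refine ENNReal.ofReal_le_ofReal ((h.mgf_le c).trans (Real.exp_le_exp.2 (le_of_eq ?_)))
  simp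
  ring

/-- With `u = xᵀ A⁻¹ s`, the exponent grows by at most `(2uε + v - u²) / (1 + v)` since `ε² ≤ 1`.
The expectation of the linear part is absorbed by `-u²`, and `exp (v / (1 + v)) ≤ 1 + v` is absorbed
by the determinant. -/
lemma lintegral_expRatio_add_le {X : Ω → ℝ} (hX : Measurable X)
    (h01 : ∀ ω, X ω ∈ Set.Icc (0 : ℝ) 1) {A : Matrix n n ℝ} (hA : A.PosDef) (x s : n → ℝ) :
    ∫⁻ ω, expRatio (A + Matrix.vecMulVec x x) (s + (X ω - ∫ ω', X ω' ∂P) • x) ∂P ≤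
      expRatio A s := by
  set μ := ∫ ω', X ω' ∂P with hμ
  have hμ0 : 0 ≤ μ := integral_nonneg fun ω => (h01 ω).1
  have hμ1 : μ ≤ 1 := by
    have := integral_mono (μ := P) (Integrable.of_mem_Icc 0 1 hX.aemeasurable
      (Filter.Eventually.of_forall h01)) (integrable_const 1) fun ω => (h01 ω).2
    simpa using this
  set v := invNormSq A x with hv
  set u := x ⬝ᵥ (A⁻¹ *ᵥ s) with hu
  have hv0 : 0 ≤ v := invNormSq_nonneg hA x
  have hv1 : 0 < 1 + v := by linarith
  have hdet := hA.det_pos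
  set C := Real.exp (invNormSq A s + (v - u ^ 2) / (1 + v)) / (A.det * (1 + v)) with hC
  have hC0 : 0 ≤ C := by positivity
  have hpt : ∀ ω, expRatio (A + Matrix.vecMulVec x x) (s + (X ω - μ) • x) ≤
      ENNReal.ofReal C * ENNReal.ofReal (Real.exp (2 * u / (1 + v) * (X ω - μ))) := by
    intro ω
    rw [expRatio, det_add_vecMulVec hA, invNormSq_add_vecMulVec hA, ← ENNReal.ofReal_mul hC0, hC,
      div_mul_eq_mul_div, ← Real.exp_add]
    refine ENNReal.ofReal_le_ofReal
      (div_le_div_of_nonneg_right (Real.exp_le_exp.2 ?_) (by positivity))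
    have hε : (X ω - μ) ^ 2 ≤ 1 := by
      have := h01 ω
      rw [sq_le_one_iff_abs_le_one, abs_le]
      constructor <;> linarith [this.1, this.2]
    rw [add_assoc, add_le_add_iff_left, div_mul_eq_mul_div, ← add_div]
    gcongr
    nlinarith
  calc ∫⁻ ω, expRatio (A + Matrix.vecMulVec x x) (s + (X ω - μ) • x) ∂P
      ≤ ∫⁻ ω, ENNReal.ofReal C * ENNReal.ofReal (Real.exp (2 * u / (1 + v) * (X ω - μ))) ∂P :=
        lintegral_mono hpt
    _ = ENNReal.ofReal C * ∫⁻ ω, ENNReal.ofReal (Real.exp (2 * u / (1 + v) * (X ω - μ))) ∂P :=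
        lintegral_const_mul _ (by fun_prop)
    _ ≤ ENNReal.ofReal C * ENNReal.ofReal (Real.exp ((2 * u / (1 + v)) ^ 2 / 8)) := by
        gcongr
        exact lintegral_exp_mul_sub_le hX h01 _
    _ ≤ expRatio A s := by
        rw [expRatio, ← ENNReal.ofReal_mul hC0]
        refine ENNReal.ofReal_le_ofReal ?_
        rw [hC, div_mul_eq_mul_div, ← Real.exp_add, div_le_div_iff₀ (by positivity) hdet]
        have h1 : invNormSq A s + (v - u ^ 2) / (1 + v) + (2 * u / (1 + v)) ^ 2 / 8 ≤
            invNormSq A s + v / (1 + v) := by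
          -- The Hoeffding exponent equals `u² / (2 (1 + v)²)`, and `v ≥ 0`.
          have h2 : (2 * u / (1 + v)) ^ 2 / 8 ≤ u ^ 2 / (1 + v) := by
            rw [div_pow, div_div, div_le_div_iff₀ (by positivity) hv1]
            nlinarith [mul_nonneg (mul_nonneg (sq_nonneg u) hv1.le) hv0,
              mul_nonneg (sq_nonneg u) hv1.le]
          rw [sub_div]
          linarith
        calc _ ≤ Real.exp (invNormSq A s + v / (1 + v)) * A.det := by gcongr
          _ = Real.exp (invNormSq A s) * A.det * Real.exp (v / (1 + v)) := by
            rw [Real.exp_add]; ring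
          _ ≤ Real.exp (invNormSq A s) * A.det * (1 + v) := by
            gcongr
            exact exp_div_one_add_le hv0
          _ = _ := by ring

/-- The outcomes are added one at a time: with that of `j` frozen, the induction hypothesis at the
updated matrix and shifted vector handles the others, which are independent of it. -/
lemma lintegral_expRatio_add_sum_le {ι : Type*} {ρ : ι → Ω → ℝ} (hρ : ∀ j, Measurable (ρ j))
    (h01 : ∀ j ω, ρ j ω ∈ Set.Icc (0 : ℝ) 1) (hind : iIndepFun ρ P) (x : ι → n → ℝ)
    (S : Finset ι) {A : Matrix n n ℝ} (hA : A.PosDef) (s : n → ℝ) :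
    ∫⁻ ω, expRatio (A + ∑ j ∈ S, Matrix.vecMulVec (x j) (x j))
      (s + ∑ j ∈ S, (ρ j ω - ∫ ω', ρ j ω' ∂P) • x j) ∂P ≤ expRatio A s := by
  classical
  induction S using Finset.induction_on generalizing A s with
  | empty => simp
  | insert j S hj ih =>
    let μ : ι → ℝ := fun j => ∫ ω', ρ j ω' ∂P
    let A' := A + Matrix.vecMulVec (x j) (x j)
    have hA' : A'.PosDef := posDef_add_vecMulVec hA _
    have hmeas : Measurable[MeasurableSpace.comap (ρ j) inferInstance] (ρ j) :=
      comap_measurable _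
    have hZ : Measurable[MeasurableSpace.comap (ρ j) inferInstance]
        fun ω => s + (ρ j ω - μ j) • x j := by
      have : Measurable fun a : ℝ => s + (a - μ j) • x j :=
        Continuous.measurable (by fun_prop)
      exact this.comp hmeas
    have hindep : IndepFun (ρ j) (fun ω (i : S) => ρ i ω) P := by
      have h := hind.indepFun_finset {j} S (Finset.disjoint_singleton_left.2 hj) hρ
      have hφ : Measurable fun g : ({j} : Finset ι) → ℝ => g ⟨j, Finset.mem_singleton_self j⟩ :=
        by fun_prop
      exact h.comp hφ measurable_id
    let f : (n → ℝ) × (S → ℝ) → ENNReal := fun p =>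
      expRatio (A' + ∑ i ∈ S, Matrix.vecMulVec (x i) (x i)) (p.1 + ∑ i : S, (p.2 i - μ i) • x i)
    have hf : Measurable f := by
      have h : Continuous fun p : (n → ℝ) × (S → ℝ) => p.1 + ∑ i : S, (p.2 i - μ i) • x i :=
        continuous_fst.add (continuous_finsetSum _ fun i _ =>
          (((continuous_apply i).comp continuous_snd).sub continuous_const).smul continuous_const)
      exact measurable_const.expRatio h.measurable
    have hsum : ∀ z ω, f (z, fun i : S => ρ i ω) =
        expRatio (A' + ∑ i ∈ S, Matrix.vecMulVec (x i) (x i))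
          (z + ∑ i ∈ S, (ρ i ω - ∫ ω', ρ i ω' ∂P) • x i) := by
      intro z ω
      simp only [f, μ]
      rw [Finset.sum_coe_sort S fun i => (ρ i ω - ∫ ω', ρ i ω' ∂P) • x i]
    have key := setLIntegral_comp_le_of_indep (P := P) (hρ j).comap_le hZ
      (measurable_pi_lambda _ fun i : S => hρ i) hindep hf
      (g := fun ω => expRatio A' (s + (ρ j ω - μ j) • x j))
      (fun ω => by simp only [hsum]; exact ih hA' _) (B := Set.univ) MeasurableSet.univ
    simp only [Measure.restrict_univ, hsum] at key
    refine le_trans (le_of_eq (lintegral_congr fun ω => ?_))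
      (key.trans (lintegral_expRatio_add_le (hρ j) (h01 j) hA (x j) s))
    rw [Finset.sum_insert hj, Finset.sum_insert hj, ← add_assoc, ← add_assoc]

end ExponentialProcess

/-! ### Ridge estimates and the deterministic comparison -/

section Deterministic

variable {d N : ℕ} {K : ℕ} {x : Fin N → Fin d → ℝ} {sel : ℕ → ℕ → Fin N} {y : ℕ → Fin N → ℝ}

lemma posDef_A (K : ℕ) (x : Fin N → Fin d → ℝ) (sel : ℕ → ℕ → Fin N) (t : ℕ) :
    (A K x sel t).PosDef := by
  induction t with
  | zero => exact Matrix.PosDef.one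
  | succ t ih => exact posDef_add_sum_vecMulVec ih x _

/-- The accumulated noise `∑_{s ≤ t} ∑_{j ∈ S_s} (y_{s,j} - μ(j)) x_j`. -/
noncomputable def noise (K : ℕ) (x : Fin N → Fin d → ℝ) (θ : Fin d → ℝ) (sel : ℕ → ℕ → Fin N)
    (y : ℕ → Fin N → ℝ) (t : ℕ) : Fin d → ℝ :=
  b K x sel y t + θ - A K x sel t *ᵥ θ

/-- The summand `θ` in `noise` cancels the contribution of `A_0 = I`. -/
lemma noise_zero (θ : Fin d → ℝ) : noise K x θ sel y 0 = 0 := by simp [noise, A, b]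

lemma noise_succ (θ : Fin d → ℝ) (t : ℕ) :
    noise K x θ sel y (t + 1) = noise K x θ sel y t +
      ∑ j ∈ selected sel (t + 1) K, (y (t + 1) j - mean x θ j) • x j := by
  simp only [noise, A, b, Matrix.add_mulVec, Matrix.sum_mulVec, Matrix.vecMulVec_mulVec, sub_smul,
    Finset.sum_sub_distrib, op_smul_eq_smul, mean]
  abel

/-- The estimation error splits into the noise and the bias caused by the regulariser. -/
lemma thetaHat_succ (θ : Fin d → ℝ) (t : ℕ) :
    thetaHat K x sel y (t + 1) =
      θ + ((A K x sel t)⁻¹ *ᵥ noise K x θ sel y t - (A K x sel t)⁻¹ *ᵥ θ) := by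
  have hdet := isUnit_det_of_posDef (posDef_A K x sel t)
  rw [← Matrix.mulVec_sub, noise, thetaHat, Nat.add_sub_cancel,
    show b K x sel y t + θ - A K x sel t *ᵥ θ - θ = b K x sel y t - A K x sel t *ᵥ θ by abel,
    Matrix.mulVec_sub, Matrix.mulVec_mulVec, Matrix.nonsing_inv_mul _ hdet, Matrix.one_mulVec]
  abel

lemma invNormSq_A_le (K : ℕ) (x : Fin N → Fin d → ℝ) (sel : ℕ → ℕ → Fin N) (t : ℕ)
    (θ : Fin d → ℝ) : invNormSq (A K x sel t) θ ≤ θ ⬝ᵥ θ := by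
  induction t with
  | zero => simp [A, invNormSq]
  | succ t ih => exact (invNormSq_add_sum_vecMulVec_le (posDef_A K x sel t) x _ θ).trans ih

/-- Cauchy–Schwarz is applied to noise and bias separately; the bias contributes the `1`, as `θᵀ
A_t⁻¹ θ ≤ θᵀ θ ≤ 1`. -/
lemma abs_dotProduct_thetaHat_sub_mean_le {θ : Fin d → ℝ} (hθ : ‖WithLp.toLp 2 θ‖ ≤ 1) (t : ℕ)
    (j : Fin N) :
    |x j ⬝ᵥ thetaHat K x sel y (t + 1) - mean x θ j| ≤
      (√(invNormSq (A K x sel t) (noise K x θ sel y t)) + 1) * Delta K x sel (t + 1) 0 j := by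
  have hA := posDef_A K x sel t
  have hΔ : Delta K x sel (t + 1) 0 j = √(invNormSq (A K x sel t) (x j)) := rfl
  have hθ' : √(invNormSq (A K x sel t) θ) ≤ 1 := by
    have h1 : θ ⬝ᵥ θ ≤ 1 := by
      have := pow_le_one₀ (norm_nonneg _) hθ (n := 2)
      rw [EuclideanSpace.norm_sq_eq] at this
      simpa [dotProduct, sq] using this
    exact Real.sqrt_le_one.2 ((invNormSq_A_le K x sel t θ).trans h1)
  rw [thetaHat_succ θ, dotProduct_add, mean, add_sub_cancel_left, dotProduct_sub, hΔ]
  have h1 := abs_dotProduct_inv_mulVec_le hA (x j) (noise K x θ sel y t)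
  have h2 := abs_dotProduct_inv_mulVec_le hA (x j) θ
  have h3 := abs_sub (x j ⬝ᵥ ((A K x sel t)⁻¹ *ᵥ noise K x θ sel y t))
    (x j ⬝ᵥ ((A K x sel t)⁻¹ *ᵥ θ))
  have h4 := Real.sqrt_nonneg (invNormSq (A K x sel t) (x j))
  nlinarith

lemma dotProduct_A_mulVec_le (hx : ∀ j, ‖WithLp.toLp 2 (x j)‖ ≤ 1) (t : ℕ) (v : Fin d → ℝ) :
    v ⬝ᵥ (A K x sel t *ᵥ v) ≤ (1 + t * N) * (v ⬝ᵥ v) := by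
  induction t with
  | zero => simp [A]
  | succ t ih =>
    have hv : 0 ≤ v ⬝ᵥ v := Finset.sum_nonneg fun i _ => mul_self_nonneg (v i)
    have h : v ⬝ᵥ ((∑ j ∈ selected sel (t + 1) K, Matrix.vecMulVec (x j) (x j)) *ᵥ v) ≤
        N * (v ⬝ᵥ v) := by
      simp only [Matrix.sum_mulVec, Matrix.vecMulVec_mulVec, op_smul_eq_smul, dotProduct_sum,
        dotProduct_smul, smul_eq_mul]
      calc _ ≤ ∑ j ∈ selected sel (t + 1) K, v ⬝ᵥ v := by
            refine Finset.sum_le_sum fun j _ => ?_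
            rw [dotProduct_comm v (x j), ← sq]
            exact sq_dotProduct_le (hx j)
        _ ≤ N * (v ⬝ᵥ v) := by
            rw [Finset.sum_const, nsmul_eq_mul]
            gcongr
            exact (Finset.card_le_univ _).trans_eq (Fintype.card_fin N)
    rw [A, Matrix.add_mulVec, dotProduct_add]
    push_cast
    linarith

lemma invNormSq_A_le_of_expRatio_lt {T : ℕ} {δ : ℝ} (hδ : δ ∈ Set.Ioo (0 : ℝ) 1)
    (hx : ∀ j, ‖WithLp.toLp 2 (x j)‖ ≤ 1) {t : ℕ} (ht : t ≤ T) {s : Fin d → ℝ}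
    (h : expRatio (A K x sel t) s < ENNReal.ofReal (1 / δ)) :
    invNormSq (A K x sel t) s ≤
      (d : ℝ) * Real.log ((1 + (N : ℝ) + (T : ℝ) * (N : ℝ)) / δ) := by
  have hA := posDef_A K x sel t
  have hδ0 := hδ.1
  -- Moving `1/δ` under the power `d` needs `δ ^ d ≤ δ`, hence `d ≥ 1`; in dimension zero the form
  -- vanishes.
  rcases Nat.eq_zero_or_pos d with rfl | hd
  · simp [invNormSq]
  have hB : (0 : ℝ) < 1 + (N : ℝ) + (T : ℝ) * (N : ℝ) := by positivity
  have hdet : (A K x sel t).det ≤ (1 + (N : ℝ) + (T : ℝ) * (N : ℝ)) ^ d := by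
    refine (det_le_pow_of_forall_dotProduct_mulVec_le hA
      (dotProduct_A_mulVec_le hx t)).trans ?_
    rw [Fintype.card_fin]
    gcongr
    linarith [Nat.cast_nonneg (α := ℝ) N]
  rw [expRatio, ENNReal.ofReal_lt_ofReal_iff (by positivity), div_lt_div_iff₀ hA.det_pos hδ0,
    one_mul, ← lt_div_iff₀ hδ0] at h
  have h1 : Real.exp (invNormSq (A K x sel t) s) ≤
      ((1 + (N : ℝ) + (T : ℝ) * (N : ℝ)) / δ) ^ d := by
    rw [div_pow]
    refine h.le.trans (div_le_div₀ (by positivity) hdet (by positivity) ?_)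
    simpa using pow_le_pow_of_le_one hδ0.le hδ.2.le hd
  rw [← Real.log_pow]
  exact (Real.le_log_iff_exp_le (by positivity)).2 h1

lemma selected_succ (sel : ℕ → ℕ → Fin N) (t k : ℕ) :
    selected sel t (k + 1) = insert (sel t (k + 1)) (selected sel t k) := by
  rw [selected, ← Finset.insert_Icc_right_eq_Icc_add_one (by omega), Finset.image_insert, selected]

lemma selected_mono (sel : ℕ → ℕ → Fin N) (t : ℕ) {k l : ℕ} (h : k ≤ l) :
    selected sel t k ⊆ selected sel t l :=
  Finset.image_subset_image (Finset.Icc_subset_Icc_right h)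

variable {T : ℕ} {α : ℝ}

lemma Astep_eq_of_isRun (hrun : IsRun T K α x sel y) {t : ℕ} (ht : t < T) {k : ℕ} (hk : k ≤ K) :
    Astep K x sel (t + 1) k =
      A K x sel t + ∑ j ∈ selected sel (t + 1) k, Matrix.vecMulVec (x j) (x j) := by
  induction k with
  | zero => simp [Astep, selected]
  | succ k ih =>
    -- No product is selected twice in a period, so the stepwise sum agrees with the sum over the
    -- set.
    have h := (hrun (t + 1) ⟨by omega, by omega⟩ (k + 1) ⟨by omega, hk⟩).1
    rw [Nat.add_sub_cancel] at h
    rw [Astep, ih (by omega), selected_succ, Finset.sum_insert h, add_assoc,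
      add_comm (Matrix.vecMulVec _ _)]

/-- The matrix at the end of a period is the one after `k` steps plus the updates of the later
steps. -/
lemma Delta_succ_zero_le (hrun : IsRun T K α x sel y) {t : ℕ} (ht : t < T) {k : ℕ} (hk : k ≤ K)
    (j : Fin N) : Delta K x sel (t + 2) 0 j ≤ Delta K x sel (t + 1) k j := by
  have hpos : (Astep K x sel (t + 1) k).PosDef := by
    rw [Astep_eq_of_isRun hrun ht hk]
    exact posDef_add_sum_vecMulVec (posDef_A K x sel t) x _
  have e : Astep K x sel (t + 2) 0 = Astep K x sel (t + 1) k +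
      ∑ j ∈ selected sel (t + 1) K \ selected sel (t + 1) k, Matrix.vecMulVec (x j) (x j) := by
    rw [Astep_eq_of_isRun hrun ht hk, add_assoc, add_comm (∑ j ∈ selected sel (t + 1) k, _),
      Finset.sum_sdiff (selected_mono sel (t + 1) hk)]
    rfl
  refine Real.sqrt_le_sqrt ?_
  rw [e]
  exact invNormSq_add_sum_vecMulVec_le hpos x _ (x j)

/-- On the event that all confidence intervals are valid, `LCB` grows as claimed. -/
lemma mean_le_of_forall_abs_le {θ : Fin d → ℝ} (hα : 0 ≤ α) (hrun : IsRun T K α x sel y)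
    (hconf : ∀ t ≤ T, ∀ j, |x j ⬝ᵥ thetaHat K x sel y (t + 1) - mean x θ j| ≤
      α * Delta K x sel (t + 1) 0 j)
    {t : ℕ} (ht : t ∈ Set.Icc 1 T) {k : ℕ} (hk : k ∈ Set.Icc 1 K) :
    (∀ j, j ∉ selected sel t K → mean x θ j - mean x θ (sel t k) ≤
      LCB K α x sel y (t + 1) j - LCB K α x sel y t j
        + 2 * α * Delta K x sel t (k - 1) (sel t k)) ∧
    0 ≤ LCB K α x sel y (t + 1) (sel t k) - LCB K α x sel y t (sel t k)
        + 2 * α * Delta K x sel t (k - 1) (sel t k) := by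
  obtain ⟨t, rfl⟩ : ∃ s, t = s + 1 := ⟨t - 1, by have := ht.1; omega⟩
  have ht' : t < T := ht.2
  have hupper : ∀ j, mean x θ j ≤
      LCB K α x sel y (t + 2) j + 2 * α * Delta K x sel (t + 1) (k - 1) j := by
    intro j
    have h1 := (abs_le.1 (hconf (t + 1) ht.2 j)).1
    have h2 := mul_le_mul_of_nonneg_left
      (Delta_succ_zero_le hrun ht' (k := k - 1) (by have := hk.2; omega) j) hα
    rw [LCB]
    linarith
  have hlower : ∀ j, LCB K α x sel y (t + 1) j ≤ mean x θ j := by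
    intro j
    have h1 := (abs_le.1 (hconf t ht'.le j)).2
    rw [LCB]
    linarith
  have hscore : ∀ j, score K α x sel y (t + 1) k j =
      LCB K α x sel y (t + 1) j + 2 * α * Delta K x sel (t + 1) (k - 1) j := fun j => rfl
  refine ⟨fun j hj => ?_, ?_⟩
  -- A product missing from the whole period was still a candidate in step `k`.
  · have h1 := (hrun (t + 1) ht k hk).2 j
      fun h => hj (selected_mono sel (t + 1) (by have := hk.2; omega) h)
    rw [hscore, hscore] at h1
    linarith [hupper j, hlower (sel (t + 1) k)]
  · linarith [hupper (sel (t + 1) k), hlower (sel (t + 1) k)]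

end Deterministic

/-! ### Measurability of the algorithm's quantities -/

section Measurability

variable {d N K : ℕ} {Ω : Type*} [MeasurableSpace Ω] {i : ℕ → ℕ → Ω → Fin N}

lemma measurableSet_mem_selected {t : ℕ} (h : ∀ k ∈ Set.Icc 1 K, Measurable (i t k)) (j : Fin N) :
    MeasurableSet {ω | j ∈ selected (fun t k => i t k ω) t K} := by
  have e : {ω | j ∈ selected (fun t k => i t k ω) t K} = ⋃ k ∈ Set.Icc 1 K, i t k ⁻¹' {j} := by
    ext ω; simp [selected]
  rw [e]
  exact MeasurableSet.biUnion (Set.to_countable _) fun k hk => h k hk (measurableSet_singleton j)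

lemma measurable_ite_mem_selected {t : ℕ} (h : ∀ k ∈ Set.Icc 1 K, Measurable (i t k))
    (j : Fin N) :
    Measurable fun ω => if j ∈ selected (fun t k => i t k ω) t K then (1 : ℝ) else 0 :=
  Measurable.ite (measurableSet_mem_selected h j) measurable_const measurable_const

lemma measurable_sum_selected {E : Type*} [AddCommMonoid E] [MeasurableSpace E] [MeasurableAdd₂ E]
    {t : ℕ} (h : ∀ k ∈ Set.Icc 1 K, Measurable (i t k)) {f : Fin N → Ω → E}
    (hf : ∀ j, Measurable (f j)) :
    Measurable fun ω => ∑ j ∈ selected (fun t k => i t k ω) t K, f j ω := by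
  -- Indicators turn the sum over a random set into a sum over a fixed one.
  have e : (fun ω => ∑ j ∈ selected (fun t k => i t k ω) t K, f j ω) =
      fun ω => ∑ j, if j ∈ selected (fun t k => i t k ω) t K then f j ω else 0 := by
    funext ω; rw [Finset.sum_ite_mem, Finset.univ_inter]
  rw [e]
  exact Finset.measurable_fun_sum _ fun j _ =>
    Measurable.ite (measurableSet_mem_selected h j) (hf j) measurable_const

lemma measurable_A (x : Fin N → Fin d → ℝ) {t : ℕ}
    (h : ∀ s ∈ Set.Icc 1 t, ∀ k ∈ Set.Icc 1 K, Measurable (i s k)) :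
    Measurable fun ω => A K x (fun t k => i t k ω) t := by
  induction t with
  | zero => exact measurable_const
  | succ t ih =>
    have h1 := ih fun s hs => h s ⟨hs.1, hs.2.trans (Nat.le_succ t)⟩
    exact h1.add (measurable_sum_selected (h (t + 1) ⟨by omega, le_rfl⟩)
      fun j => measurable_const)

lemma measurable_noise (x : Fin N → Fin d → ℝ) (θ : Fin d → ℝ) {r : ℕ → Fin N → Ω → ℝ} {t : ℕ}
    (h : ∀ s ∈ Set.Icc 1 t, ∀ k ∈ Set.Icc 1 K, Measurable (i s k))
    (hr : ∀ s ∈ Set.Icc 1 t, ∀ j, Measurable (r s j)) :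
    Measurable fun ω => noise K x θ (fun t k => i t k ω) (fun t j => r t j ω) t := by
  induction t with
  | zero => simp only [noise_zero]; exact measurable_const
  | succ t ih =>
    have h1 := ih (fun s hs => h s ⟨hs.1, hs.2.trans (Nat.le_succ t)⟩)
      (fun s hs => hr s ⟨hs.1, hs.2.trans (Nat.le_succ t)⟩)
    simp only [noise_succ]
    exact h1.add (measurable_sum_selected (h (t + 1) ⟨by omega, le_rfl⟩)
      fun j => ((hr (t + 1) ⟨by omega, le_rfl⟩ j).sub_const _).smul_const _)

end Measurability

/-! ### The filtration of past outcomes and the seed -/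

section History

variable {N : ℕ} {Ω 𝓥 : Type*} [MeasurableSpace 𝓥]
  {V : Ω → 𝓥} {r : ℕ → Fin N → Ω → ℝ}

lemma history_mono (V : Ω → 𝓥) (r : ℕ → Fin N → Ω → ℝ) : Monotone (history V r) := by
  intro s t hst
  refine sup_le_sup le_rfl (iSup₂_le fun u hu => ?_)
  exact le_iSup₂_of_le u ⟨hu.1, hu.2.trans_le hst⟩ le_rfl

lemma measurable_history {s t : ℕ} (hs : s ∈ Set.Ico 1 t) (j : Fin N) :
    Measurable[history V r t] (r s j) := by
  refine Measurable.of_comap_le (le_sup_of_le_right ?_)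
  exact le_iSup₂_of_le s hs (le_iSup_of_le j le_rfl)

variable [mΩ : MeasurableSpace Ω] {P : Measure Ω}

lemma history_le {T : ℕ} (hV : Measurable V) (hr : ∀ t ∈ Set.Icc 1 T, ∀ j, Measurable (r t j))
    {t : ℕ} (ht : t ≤ T + 1) : history V r t ≤ mΩ := by
  refine sup_le hV.comap_le (iSup₂_le fun s hs => iSup_le fun j => ?_)
  exact (hr s ⟨hs.1, by have := hs.2; omega⟩ j).comap_le

/-- Past and present outcomes form disjoint blocks of an independent family, and the seed is
independent of both together. -/
lemma indep_history [IsProbabilityMeasure P] {T : ℕ} (hV : Measurable V)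
    (hr : ∀ t ∈ Set.Icc 1 T, ∀ j, Measurable (r t j))
    (hind : iIndepFun (fun (p : Set.Icc 1 T × Fin N) => r p.1 p.2) P)
    (hVr : IndepFun V (fun ω (p : Set.Icc 1 T × Fin N) => r p.1 p.2 ω) P)
    {t : ℕ} (ht : t ∈ Set.Icc 1 T) :
    Indep (history V r t) (MeasurableSpace.comap (fun ω j => r t j ω) inferInstance) P := by
  let m : Set.Icc 1 T × Fin N → MeasurableSpace Ω := fun p =>
    MeasurableSpace.comap (r p.1 p.2) inferInstance
  have hm : ∀ p, m p ≤ mΩ := fun p => (hr p.1 p.1.2 p.2).comap_le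
  let past : Set (Set.Icc 1 T × Fin N) := {p | (p.1 : ℕ) < t}
  let now : Set (Set.Icc 1 T × Fin N) := {p | (p.1 : ℕ) = t}
  have hdisj : Disjoint past now := by
    rw [Set.disjoint_left]
    intro p (hp : (p.1 : ℕ) < t) (hp' : (p.1 : ℕ) = t)
    omega
  have h' : Indep (⨆ p ∈ past, m p) (⨆ p ∈ now, m p) P :=
    indep_iSup_of_disjoint hm hind.iIndep hdisj
  have hall : ∀ S : Set (Set.Icc 1 T × Fin N), ⨆ p ∈ S, m p ≤
      MeasurableSpace.comap (fun ω (p : Set.Icc 1 T × Fin N) => r p.1 p.2 ω) inferInstance := by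
    refine fun S => iSup₂_le fun p _ => ?_
    have h1 : Measurable[MeasurableSpace.comap
        (fun ω (p : Set.Icc 1 T × Fin N) => r p.1 p.2 ω) inferInstance] (r p.1 p.2) :=
      (measurable_pi_apply p).comp
        (comap_measurable fun ω (p : Set.Icc 1 T × Fin N) => r p.1 p.2 ω)
    exact h1.comap_le
  have h : Indep (MeasurableSpace.comap V inferInstance)
      ((⨆ p ∈ past, m p) ⊔ ⨆ p ∈ now, m p) P :=
    indep_of_indep_of_le_right hVr (sup_le (hall _) (hall _))
  have key := indep_sup_of_indep_sup hV.comap_le (iSup₂_le fun p _ => hm p)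
    (iSup₂_le fun p _ => hm p) h h'
  refine indep_of_indep_of_le_left (indep_of_indep_of_le_right key ?_) (sup_le_sup le_rfl ?_)
  · have h1 : Measurable[⨆ p ∈ now, m p] fun ω j => r t j ω := by
      refine @measurable_pi_lambda _ _ _ (⨆ p ∈ now, m p) _ _ fun j => Measurable.of_comap_le ?_
      exact le_iSup₂_of_le (f := fun p (_ : p ∈ now) => m p) (⟨t, ht⟩, j) rfl le_rfl
    exact h1.comap_le
  · refine iSup₂_le fun s hs => iSup_le fun j => ?_
    exact le_iSup₂_of_le (f := fun p (_ : p ∈ past) => m p)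
      (⟨s, hs.1, by have := hs.2; have := ht.2; omega⟩, j) hs.2 le_rfl

end History

/-! ### The supermartingale and the confidence event -/

section Confidence

variable {d N T K : ℕ} {Ω 𝓥 : Type*} [MeasurableSpace 𝓥] {x : Fin N → Fin d → ℝ} {θ : Fin d → ℝ}
  {V : Ω → 𝓥} {r : ℕ → Fin N → Ω → ℝ} {i : ℕ → ℕ → Ω → Fin N}

/-- The process `exp (s_tᵀ A_t⁻¹ s_t) / det A_t`, where `s_t` is the accumulated noise. -/
noncomputable def expProcess (K : ℕ) (x : Fin N → Fin d → ℝ) (θ : Fin d → ℝ)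
    (r : ℕ → Fin N → Ω → ℝ) (i : ℕ → ℕ → Ω → Fin N) (t : ℕ) (ω : Ω) : ENNReal :=
  expRatio (A K x (fun t k => i t k ω) t)
    (noise K x θ (fun t k => i t k ω) (fun t j => r t j ω) t)

lemma measurable_sel_history
    (hi : ∀ t ∈ Set.Icc 1 T, ∀ k ∈ Set.Icc 1 K, Measurable[history V r t] (i t k))
    {t u : ℕ} (ht : t ≤ T) (htu : t ≤ u) :
    ∀ s ∈ Set.Icc 1 t, ∀ k ∈ Set.Icc 1 K, Measurable[history V r u] (i s k) :=
  fun _ hs k hk => (hi _ ⟨hs.1, hs.2.trans ht⟩ k hk).mono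
    (history_mono V r (hs.2.trans htu)) le_rfl

lemma measurable_noise_history
    (hi : ∀ t ∈ Set.Icc 1 T, ∀ k ∈ Set.Icc 1 K, Measurable[history V r t] (i t k))
    {t : ℕ} (ht : t ≤ T) : Measurable[history V r (t + 1)]
      fun ω => noise K x θ (fun t k => i t k ω) (fun t j => r t j ω) t :=
  @measurable_noise d N K Ω (history V r (t + 1)) i x θ r t
    (measurable_sel_history hi ht (Nat.le_succ t))
    fun _ hs => measurable_history ⟨hs.1, Nat.lt_succ_of_le hs.2⟩

lemma measurable_expProcess
    (hi : ∀ t ∈ Set.Icc 1 T, ∀ k ∈ Set.Icc 1 K, Measurable[history V r t] (i t k))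
    {t : ℕ} (ht : t ≤ T) : Measurable[history V r (t + 1)] (expProcess K x θ r i t) := by
  have hA := @measurable_A d N K Ω (history V r (t + 1)) i x t
    (measurable_sel_history hi ht (Nat.le_succ t))
  have h := @Measurable.expRatio (Fin d) _ _ Ω (history V r (t + 1)) _ _ hA
    (measurable_noise_history (x := x) (θ := θ) hi ht)
  exact h

variable [mΩ : MeasurableSpace Ω] {P : Measure Ω} [IsProbabilityMeasure P]

/-- Selections do not anticipate, so `A_{t+1}` is already known from `history V r (t + 1)`; only the
outcomes of period `t + 1` are fresh, and they are integrated out with the history frozen. -/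
lemma setLIntegral_expProcess_succ_le (hr : IsOutcomeModel P T x θ r) (hV : Measurable V)
    (hVr : IndepFun V (fun ω (p : Set.Icc 1 T × Fin N) => r p.1 p.2 ω) P)
    (hi : ∀ t ∈ Set.Icc 1 T, ∀ k ∈ Set.Icc 1 K, Measurable[history V r t] (i t k))
    {t : ℕ} (ht : t < T) {B : Set Ω} (hB : MeasurableSet[history V r (t + 1)] B) :
    ∫⁻ ω in B, expProcess K x θ r i (t + 1) ω ∂P ≤ ∫⁻ ω in B, expProcess K x θ r i t ω ∂P := by
  have ht1 : t + 1 ∈ Set.Icc 1 T := ⟨by omega, ht⟩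
  let S : Ω → Finset (Fin N) := fun ω => selected (fun t k => i t k ω) (t + 1) K
  -- The random set enters as a 0-1 vector, making the new noise a continuous function of history
  -- and outcomes.
  let w : Ω → Fin N → ℝ := fun ω j => if j ∈ S ω then 1 else 0
  let Z : Ω → Matrix (Fin d) (Fin d) ℝ × (Fin d → ℝ) × (Fin N → ℝ) := fun ω =>
    (A K x (fun t k => i t k ω) (t + 1),
      noise K x θ (fun t k => i t k ω) (fun t j => r t j ω) t, w ω)
  have hw : Measurable[history V r (t + 1)] w := by
    refine @measurable_pi_lambda _ _ _ (history V r (t + 1)) _ _ fun j => ?_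
    exact @measurable_ite_mem_selected N K Ω (history V r (t + 1)) i (t + 1) (hi _ ht1) j
  have hZ : Measurable[history V r (t + 1)] Z :=
    Measurable.prodMk (@measurable_A d N K Ω (history V r (t + 1)) i x (t + 1)
      (measurable_sel_history hi ht le_rfl))
      (Measurable.prodMk (measurable_noise_history hi ht.le) hw)
  let g : (Matrix (Fin d) (Fin d) ℝ × (Fin d → ℝ) × (Fin N → ℝ)) × (Fin N → ℝ) → Fin d → ℝ :=
    fun p => p.1.2.1 + ∑ j, (p.1.2.2 j * (p.2 j - mean x θ j)) • x j
  have hg : Continuous g := by fun_prop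
  have hf := Measurable.expRatio
    (measurable_fst.fst : Measurable fun p : (Matrix (Fin d) (Fin d) ℝ × (Fin d → ℝ) ×
      (Fin N → ℝ)) × (Fin N → ℝ) => p.1.1) hg.measurable
  have hsum : ∀ ω ω', g (Z ω, fun j => r (t + 1) j ω') =
      noise K x θ (fun t k => i t k ω) (fun t j => r t j ω) t +
        ∑ j ∈ S ω, (r (t + 1) j ω' - mean x θ j) • x j := by
    intro ω ω'
    simp only [g, Z, w, ite_mul, one_mul, zero_mul, ite_smul, zero_smul]
    rw [Finset.sum_ite_mem, Finset.univ_inter]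
  have hindep : iIndepFun (fun j => r (t + 1) j) P :=
    hr.indep.precomp (g := fun j : Fin N => ((⟨t + 1, ht1⟩, j) : Set.Icc 1 T × Fin N))
      fun a b hab => (Prod.ext_iff.1 hab).2
  have hstep : ∀ ω, ∫⁻ ω', expRatio (Z ω).1 (g (Z ω, fun j => r (t + 1) j ω')) ∂P ≤
      expProcess K x θ r i t ω := by
    intro ω
    have h := lintegral_expRatio_add_sum_le (P := P) (hr.measurable (t + 1) ht1)
      (fun j ω' => by rcases hr.binary (t + 1) ht1 j ω' with h | h <;> rw [h] <;> simp)
      hindep x (S ω) (posDef_A K x (fun t k => i t k ω) t)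
      (noise K x θ (fun t k => i t k ω) (fun t j => r t j ω) t)
    simp only [hr.expectation (t + 1) ht1] at h
    simp only [hsum]
    exact h
  have key := setLIntegral_comp_le_of_indep (P := P) (history_le hV hr.measurable (by omega)) hZ
    (measurable_pi_lambda _ fun j => hr.measurable (t + 1) ht1 j)
    (indep_history hV hr.measurable hr.indep hVr ht1) hf hstep hB
  refine le_trans (le_of_eq (lintegral_congr fun ω => ?_)) key
  rw [hsum, expProcess, noise_succ]

lemma measure_exists_le_expProcess_le {δ : ℝ} (hδ : 0 < δ) (hr : IsOutcomeModel P T x θ r)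
    (hV : Measurable V)
    (hVr : IndepFun V (fun ω (p : Set.Icc 1 T × Fin N) => r p.1 p.2 ω) P)
    (hi : ∀ t ∈ Set.Icc 1 T, ∀ k ∈ Set.Icc 1 K, Measurable[history V r t] (i t k)) :
    P {ω | ∃ t ≤ T, ENNReal.ofReal (1 / δ) ≤ expProcess K x θ r i t ω} ≤ ENNReal.ofReal δ := by
  have h0 : ∀ ω, expProcess K x θ r i 0 ω = 1 := fun ω => by
    simp [expProcess, expRatio, noise_zero, A, invNormSq]
  -- The filtration is shifted by one: `history V r (t + 1)` holds the outcomes of periods up to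
  -- `t`.
  have h := measure_exists_le_of_supermartingale (P := P) (T := T)
    (fun t => history V r (t + 1)) (fun t ht => history_le hV hr.measurable (by omega))
    (fun s t hst => history_mono V r (by omega)) (expProcess K x θ r i)
    (fun t ht => measurable_expProcess hi ht) (by simp [h0])
    (fun t ht B hB => setLIntegral_expProcess_succ_le hr hV hVr hi ht hB)
    (ENNReal.ofReal (1 / δ))
  rw [one_div, ENNReal.ofReal_inv_of_pos hδ] at h ⊢
  rwa [mul_comm, ← div_eq_mul_inv, ENNReal.div_le_iff (by simpa using hδ) ENNReal.ofReal_ne_top,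
    one_mul] at h

end Confidence

end ConsUCB

/-! ### Proof of the proposition -/

theorem proposition1
    {Ω : Type*} [MeasurableSpace Ω] (P : Measure Ω) [IsProbabilityMeasure P]
    (d N T K : ℕ) (δ α : ℝ) (hδ : δ ∈ Set.Ioo (0 : ℝ) 1)
    (hα : α = √((d : ℝ) * Real.log ((1 + (N : ℝ) + (T : ℝ) * (N : ℝ)) / δ)) + 1)
    -- feature vectors, unknown parameter, optimal product set
    (x : Fin N → Fin d → ℝ) (θstar : Fin d → ℝ)
    (hx : ∀ j, ‖WithLp.toLp 2 (x j)‖ ≤ 1) (hθ : ‖WithLp.toLp 2 θstar‖ ≤ 1)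
    (hμ : ∀ j, ConsUCB.mean x θstar j ∈ Set.Icc (0 : ℝ) 1)
    (Sstar : Finset (Fin N)) (hS : ConsUCB.IsOptimalSet K x θstar Sstar)
    -- outcomes
    (r : ℕ → Fin N → Ω → ℝ) (hr : ConsUCB.IsOutcomeModel P T x θstar r)
    -- a random seed for breaking ties, independent of the outcomes
    {𝓥 : Type*} [MeasurableSpace 𝓥] (V : Ω → 𝓥) (hV : Measurable V)
    (hVr : IndepFun V (fun ω (p : Set.Icc 1 T × Fin N) => r p.1 p.2 ω) P)
    -- the selections `i t k` of ConsUCB, which are made without knowledge of the future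
    (i : ℕ → ℕ → Ω → Fin N)
    (hi : ∀ t ∈ Set.Icc 1 T, ∀ k ∈ Set.Icc 1 K, Measurable[ConsUCB.history V r t] (i t k))
    (hrun : ∀ ω, ConsUCB.IsRun T K α x (fun t k => i t k ω) (fun t j => r t j ω)) :
    ENNReal.ofReal (1 - δ) ≤ P {ω | ∀ t ∈ Set.Icc 1 T, ∀ k ∈ Set.Icc 1 K,
      (i t k ω ∉ Sstar →
        ∀ istar ∈ Sstar \ ConsUCB.selected (fun t k => i t k ω) t K,
          ConsUCB.mean x θstar istar - ConsUCB.mean x θstar (i t k ω) ≤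
            ConsUCB.LCB K α x (fun t k => i t k ω) (fun t j => r t j ω) (t + 1) istar
              - ConsUCB.LCB K α x (fun t k => i t k ω) (fun t j => r t j ω) t istar
              + 2 * α * ConsUCB.Delta K x (fun t k => i t k ω) t (k - 1) (i t k ω)) ∧
      (i t k ω ∈ Sstar →
          0 ≤ ConsUCB.LCB K α x (fun t k => i t k ω) (fun t j => r t j ω) (t + 1) (i t k ω)
              - ConsUCB.LCB K α x (fun t k => i t k ω) (fun t j => r t j ω) t (i t k ω)
              + 2 * α * ConsUCB.Delta K x (fun t k => i t k ω) t (k - 1) (i t k ω))} := by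
  have hα0 : 0 ≤ α := by rw [hα]; positivity
  have hbad := ConsUCB.measure_exists_le_expProcess_le hδ.1 hr hV hVr hi
  set E := {ω | ∃ t ≤ T, ENNReal.ofReal (1 / δ) ≤ ConsUCB.expProcess K x θstar r i t ω} with hE
  have hgood : ENNReal.ofReal (1 - δ) ≤ P Eᶜ := by
    have h1 : 1 ≤ P E + P Eᶜ := by
      rw [← measure_univ (μ := P), ← Set.union_compl_self E]
      exact measure_union_le _ _
    rw [ENNReal.ofReal_sub _ hδ.1.le, ENNReal.ofReal_one]
    exact tsub_le_iff_left.2 (h1.trans (add_le_add_left hbad _))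
  refine hgood.trans (measure_mono fun ω hω => ?_)
  -- The range `t ≤ T` includes `t = T`: the comparison in the last period uses the estimate
  -- `θ_{T+1}`.
  have hconf : ∀ t ≤ T, ∀ j, |x j ⬝ᵥ ConsUCB.thetaHat K x (fun t k => i t k ω)
      (fun t j => r t j ω) (t + 1) - ConsUCB.mean x θstar j| ≤
        α * ConsUCB.Delta K x (fun t k => i t k ω) (t + 1) 0 j := by
    intro t ht j
    have hlt : ConsUCB.expProcess K x θstar r i t ω < ENNReal.ofReal (1 / δ) := by
      by_contra h
      exact hω ⟨t, ht, not_lt.1 h⟩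
    refine (ConsUCB.abs_dotProduct_thetaHat_sub_mean_le hθ t j).trans ?_
    refine mul_le_mul_of_nonneg_right ?_ (Real.sqrt_nonneg _)
    rw [hα]
    gcongr
    exact ConsUCB.invNormSq_A_le_of_expRatio_lt hδ hx ht hlt
  intro t ht k hk
  obtain ⟨h1, h2⟩ := ConsUCB.mean_le_of_forall_abs_le hα0 (hrun ω) hconf ht hk
  exact ⟨fun _ j hj => h1 j (Finset.mem_sdiff.1 hj).2, fun _ => h2⟩
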